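/- Theorem (System $\mathcal W$ of graded combinatory logic is confluent). Let $\mathbb L=([0,\infty],\ge,+,0)$ be the Lawvere quantale. On $[0,\infty]$ let $n\cdot m$ be the usual product, extended by $x\cdot\infty=\infty$ for every $x$ (including $x=0$), $\infty\cdot 0=0$, and $\infty\cdot y=\infty$ for $y\ne 0$. The terms of system $\mathcal W$ are built from countably many variables and the constants $\mathtt B,\mathtt C,\mathtt K,\mathtt D$, $\mathtt W_{n,m}$, $\delta_{n,m}$, $\mathtt F_n$ ($n,m\in[0,\infty]$) by binary application $t\cdot s$ (associating to the left) and the unary modalities $!_n t$ ($n\in[0,\infty]$). The ground rules, all at distance $0$, are $$\mathtt B\cdot x\cdot y\cdot z\stackrel{0}{\mapsto}x\cdot(y\cdot z),\qquad \mathtt C\cdot x\cdot y\cdot z\stackrel{0}{\mapsto}x\cdot z\cdot y,\qquad \mathtt K\cdot x\cdot{!_0}y\stackrel{0}{\mapsto}x,\qquad \mathtt D\cdot{!_1}x\stackrel{0}{\mapsto}x,$$ $$\delta_{n,m}\cdot{!_{nm}}x\stackrel{0}{\mapsto}{!_n}{!_m}x,\qquad \mathtt F_n\cdot{!_n}x\cdot{!_n}y\stackrel{0}{\mapsto}{!_n}(x\cdot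 y),\qquad \mathtt W_{n,m}\cdot x\cdot{!_{n+m}}y\stackrel{0}{\mapsto}x\cdot{!_n}y\cdot{!_m}y .$$ The grade $\partial\mathcal C\in[0,\infty]$ of a one-hole context is defined by $\partial[-]=1$, $\partial(\mathcal C\cdot s)=\partial(t\cdot\mathcal C)=\partial\mathcal C$ and $\partial({!_n}\mathcal C)=n\cdot\partial\mathcal C$. The graded reduction $\stackrel{\varepsilon}{\to}$ is the least relation such that: if $a\stackrel{\varepsilon}{\mapsto}b$, then $\mathcal C[a^\sigma]\stackrel{\partial\mathcal C\cdot\varepsilon}{\longrightarrow}\mathcal C[b^\sigma]$ for every one-hole context $\mathcal C$ and every substitution $\sigma$; and if $e\stackrel{\varepsilon}{\to}f$ and $\varepsilon\le\varepsilon'$ (in the usual order of $[0,\infty]$), then $e\stackrel{\varepsilon'}{\to}f$. Put $R(e,f)=\inf\{\varepsilon\in[0,\infty]\mid e\stackrel{\varepsilon}{\to}f\}$, with $\inf\emptyset=\infty$. Let $R^0(e,f)=0$ if $e=f$ and $\infty$ otherwise, let $R^{k+1}(e,f)=\inf_g\big(R(e,g)+R^k(g,f)\big)$, and let $R^*(e,f)=\inf_{k\ge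 0}R^k(e,f)$. Then $\mathcal W$ is confluent, i.e. $R^*$ has the diamond property: for all terms $a,b$, $$\inf_{d}\big(R^*(a,d)+R^*(b,d)\big)\;\le\;\inf_{c}\big(R^*(c,a)+R^*(c,b)\big).$$ -/

import Mathlib

open scoped ENNReal

/-! Quantitative relations over the Lawvere quantale `([0,∞], ≥, +, 0)`.  Its order is the
reverse of the usual order of `ℝ≥0∞`: joins are infima, the unit `0` is the top element and `∞`
is the bottom element.  Below, `≤` and `⨅` always refer to the usual order of `ℝ≥0∞`. -/

/-- A relation with values in the Lawvere quantale. -/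
abbrev LRel (A B : Type*) : Type _ := A → B → ℝ≥0∞

namespace LRel

variable {A B C : Type*}

/-- The diagonal relation: the unit `0` on the diagonal, the bottom `∞` elsewhere. -/
noncomputable def diag (A : Type*) : LRel A A := fun a b => ⨅ _ : a = b, 0

/-- Composition `(R ; S)(a, c) = inf_b R(a, b) + S(b, c)`. -/
noncomputable def comp (R : LRel A B) (S : LRel B C) : LRel A C :=
  fun a c => ⨅ b, R a b + S b c

/-- The transpose of a relation. -/
def dual (R : LRel A B) : LRel B A := fun b a => R a b

/-- The iterates: `R⁰` is the diagonal and `Rⁿ⁺¹ = R ; Rⁿ`. -/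
noncomputable def iter (R : LRel A A) : ℕ → LRel A A
  | 0 => diag A
  | n + 1 => comp R (iter R n)

/-- The reflexive and transitive closure, i.e. the join of all the iterates. -/
noncomputable def star (R : LRel A A) : LRel A A := fun a b => ⨅ n : ℕ, iter R n a b

/-- The diamond property: `Rᵒ ; R` is below `R ; Rᵒ` in the order of the quantale, i.e. for all
`a`, `b` one has `inf_d R(a, d) + R(b, d) ≤ inf_c R(c, a) + R(c, b)`. -/
def Diamond (R : LRel A A) : Prop :=
  ∀ a b, comp R (dual R) a b ≤ comp (dual R) R a b

/-- A relation is confluent if its reflexive and transitive closure has the diamond property. -/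
def Confluent (R : LRel A A) : Prop := Diamond (star R)

end LRel

namespace GradedCL

/-- Extended multiplication on `[0,∞]`, with `x · ∞ = ∞` for every `x` (also for `x = 0`),
`∞ · 0 = 0` and `∞ · y = ∞` for `y ≠ 0`.  Grades compose by it and act by it on distances. -/
noncomputable def gmul (x y : ℝ≥0∞) : ℝ≥0∞ := if y = ∞ then ∞ else x * y

/-- Terms over the graded signature: the basic combinators `B`, `C`, `K`, `W_{n,m}`, `D`,
`δ_{n,m}`, `F_n`, the modalities `!_n` and application, for `n, m ∈ [0,∞]`. -/
inductive Term : Type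
  | var (i : ℕ) : Term
  | B : Term
  | C : Term
  | K : Term
  | W (n m : ℝ≥0∞) : Term
  | D : Term
  | δ (n m : ℝ≥0∞) : Term
  | F (n : ℝ≥0∞) : Term
  | bang (n : ℝ≥0∞) (t : Term) : Term
  | app (t s : Term) : Term

infixl:70 " ⬝ " => Term.app

namespace Term

/-- Simultaneous substitution of terms for variables. -/
def subst (σ : ℕ → Term) : Term → Term
  | var i => σ i
  | B => B
  | C => C
  | K => K
  | W n m => W n m
  | D => D
  | δ n m => δ n m
  | F n => F n
  | bang n t => bang n (subst σ t)
  | app t s => subst σ t ⬝ subst σ s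

end Term

/-- Contexts with exactly one hole. -/
inductive Ctx : Type
  | hole : Ctx
  | appL (E : Ctx) (s : Term) : Ctx
  | appR (t : Term) (E : Ctx) : Ctx
  | bang (n : ℝ≥0∞) (E : Ctx) : Ctx

namespace Ctx

/-- Plugging a term into the hole. -/
def fill : Ctx → Term → Term
  | hole, u => u
  | appL E s, u => fill E u ⬝ s
  | appR t E, u => t ⬝ fill E u
  | bang n E, u => Term.bang n (fill E u)

/-- The sensitivity of the hole of a context: application has sensitivity `1` in both arguments,
the modality `!_n` has sensitivity `n`. -/
noncomputable def grade : Ctx → ℝ≥0∞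
  | hole => 1
  | appL E _ => grade E
  | appR _ E => grade E
  | bang n E => gmul n (grade E)

end Ctx

open Term in
/-- The ground rewriting rules; `Rule ε a b` says that `a` is rewritten to `b` at distance `ε`.
The variables `x`, `y`, `z` of the rules are `var 0`, `var 1`, `var 2`. -/
inductive Rule : ℝ≥0∞ → Term → Term → Prop
  | B : Rule 0 (B ⬝ var 0 ⬝ var 1 ⬝ var 2) (var 0 ⬝ (var 1 ⬝ var 2))
  | C : Rule 0 (C ⬝ var 0 ⬝ var 1 ⬝ var 2) (var 0 ⬝ var 2 ⬝ var 1)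
  | K : Rule 0 (K ⬝ var 0 ⬝ bang 0 (var 1)) (var 0)
  | D : Rule 0 (D ⬝ bang 1 (var 0)) (var 0)
  | δ (n m : ℝ≥0∞) : Rule 0 (δ n m ⬝ bang (gmul n m) (var 0)) (bang n (bang m (var 0)))
  | F (n : ℝ≥0∞) :
      Rule 0 (F n ⬝ bang n (var 0) ⬝ bang n (var 1)) (bang n (var 0 ⬝ var 1))
  | W (n m : ℝ≥0∞) :
      Rule 0 (W n m ⬝ var 0 ⬝ bang (n + m) (var 1)) (var 0 ⬝ bang n (var 1) ⬝ bang m (var 1))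

/-- The graded reduction: a rule of distance `ε` may be applied to any substitution instance inside
any one-hole context, which multiplies `ε` by the sensitivity of the hole; and distances may be
weakened, that is, increased in the usual order of `[0,∞]`. -/
inductive Step : ℝ≥0∞ → Term → Term → Prop
  | ctx {ε : ℝ≥0∞} {a b : Term} (E : Ctx) (σ : ℕ → Term) (h : Rule ε a b) :
      Step (gmul E.grade ε) (E.fill (a.subst σ)) (E.fill (b.subst σ))
  | weaken {ε ε' : ℝ≥0∞} {e f : Term} (h : Step ε e f) (hε : ε ≤ ε') : Step ε' e f

/-- The rewriting distance of system `W`: `R(e, f)` is the infimum of all `ε` such that `e` reduces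
to `f` at distance `ε`. -/
noncomputable def systemW : LRel Term Term := fun e f => sInf {ε | Step ε e f}

end GradedCL

/-!
Every ground rule of system `W` has distance `0`, and `gmul g 0 = 0` for every grade `g`, so a
graded reduction at any distance is also one at distance `0` (`GradedCL.Step.zero`).  Hence
`star systemW a b` is `0` when `a` reduces to `b` in finitely many ordinary steps and `∞` otherwise,
and the quantitative diamond property amounts to ordinary confluence of the rewriting system
(`GradedCL.reds_confluent`).

The rewriting system is orthogonal: left-hand sides are linear, and the combinator at the head of a
redex, indices included, determines its rule.  Its confluence is proved in the style of
Tait, Martin-Löf and Takahashi, with a parallel reduction `Par` that reduces both sides of an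
application and then possibly contracts the resulting redex (which may have been created by these
reductions).  Three facts carry the argument: contraction at the root is deterministic
(`Root.unique`); parallel reduction of the two sides of a redex leaves a redex, and the two
contracta are again related (`Root.stable`); consequently, every term `a` has a complete
development, a term to which all parallel reducts of `a` reduce in parallel (`Par.exists_top`).
That a proper part of a redex stays such a part under reduction is tracked by `missing`, the number
of arguments that the head combinator still waits for.
-/

namespace GradedCL

open Relation

/-! ### Contraction at the root -/

/-- `Root a b`: the term `a` is a redex and `b` is its contractum.  These are the substitution
instances of the ground rules. -/
inductive Root : Term → Term → Prop
  | B (x y z : Term) : Root (Term.B ⬝ x ⬝ y ⬝ z) (x ⬝ (y ⬝ z))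
  | C (x y z : Term) : Root (Term.C ⬝ x ⬝ y ⬝ z) (x ⬝ z ⬝ y)
  | K (x y : Term) : Root (Term.K ⬝ x ⬝ Term.bang 0 y) x
  | D (x : Term) : Root (Term.D ⬝ Term.bang 1 x) x
  | δ (n m : ℝ≥0∞) (x : Term) :
      Root (Term.δ n m ⬝ Term.bang (gmul n m) x) (Term.bang n (Term.bang m x))
  | F (n : ℝ≥0∞) (x y : Term) :
      Root (Term.F n ⬝ Term.bang n x ⬝ Term.bang n y) (Term.bang n (x ⬝ y))
  | W (n m : ℝ≥0∞) (x y : Term) :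
      Root (Term.W n m ⬝ x ⬝ Term.bang (n + m) y) (x ⬝ Term.bang n y ⬝ Term.bang m y)

theorem Rule.eq_zero {ε : ℝ≥0∞} {a b : Term} (h : Rule ε a b) : ε = 0 := by
  cases h <;> rfl

theorem Rule.root {ε : ℝ≥0∞} {a b : Term} (h : Rule ε a b) (σ : ℕ → Term) :
    Root (a.subst σ) (b.subst σ) := by
  cases h <;> constructor

theorem Root.exists_rule {a b : Term} (h : Root a b) :
    ∃ (l r : Term) (σ : ℕ → Term), Rule 0 l r ∧ l.subst σ = a ∧ r.subst σ = b := by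
  cases h with
  | B x y z => exact ⟨_, _, fun i => if i = 0 then x else if i = 1 then y else z, .B, rfl, rfl⟩
  | C x y z => exact ⟨_, _, fun i => if i = 0 then x else if i = 1 then y else z, .C, rfl, rfl⟩
  | K x y => exact ⟨_, _, fun i => if i = 0 then b else y, .K, rfl, rfl⟩
  | D x => exact ⟨_, _, fun _ => b, .D, rfl, rfl⟩
  | δ n m x => exact ⟨_, _, fun _ => x, .δ n m, rfl, rfl⟩
  | F n x y => exact ⟨_, _, fun i => if i = 0 then x else y, .F n, rfl, rfl⟩
  | W n m x y => exact ⟨_, _, fun i => if i = 0 then x else y, .W n m, rfl, rfl⟩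

theorem Root.unique {a b c : Term} (hb : Root a b) (hc : Root a c) : b = c := by
  cases hb <;> cases hc <;> rfl

/-- The number of arguments that the combinator at the head of a term still needs before it can
form a redex; it is `0` if the head is a variable or a modality, or if there are enough
arguments. -/
def missing : Term → ℕ
  | .B => 3
  | .C => 3
  | .K => 2
  | .W _ _ => 2
  | .D => 1
  | .δ _ _ => 1
  | .F _ => 2
  | .var _ => 0
  | .bang _ _ => 0
  | .app t _ => missing t - 1

theorem Root.missing_eq_one {t s u : Term} (h : Root (t ⬝ s) u) : missing t = 1 := by
  cases h <;> rfl

/-! ### Parallel reduction -/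

/-- Parallel reduction.  The redex contracted by `Par.root` is the one found after reducing both
sides of the application, so it need not be visible in the source term. -/
inductive Par : Term → Term → Prop
  | refl (t : Term) : Par t t
  | bang (n : ℝ≥0∞) {t t' : Term} : Par t t' → Par (Term.bang n t) (Term.bang n t')
  | app {t t' s s' : Term} : Par t t' → Par s s' → Par (t ⬝ s) (t' ⬝ s')
  | root {t t' s s' u : Term} : Par t t' → Par s s' → Root (t' ⬝ s') u → Par (t ⬝ s) u

theorem Par.missing_eq {t t' : Term} (h : Par t t') (ht : missing t ≠ 0) :
    missing t' = missing t := by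
  induction h with
  | refl => rfl
  | bang => exact absurd rfl ht
  | app _ _ ih _ =>
    simp only [missing] at ht ⊢
    rw [ih (by omega)]
  | root _ _ hr ih _ =>
    have := hr.missing_eq_one
    simp only [missing] at ht
    have := ih (by omega)
    omega

theorem Par.app_inv {t s u : Term} (h : Par (t ⬝ s) u) (ht : 2 ≤ missing t) :
    ∃ t' s', u = t' ⬝ s' ∧ Par t t' ∧ Par s s' := by
  cases h with
  | refl => exact ⟨t, s, rfl, .refl _, .refl _⟩
  | app h₁ h₂ => exact ⟨_, _, rfl, h₁, h₂⟩
  | root h₁ h₂ hr =>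
    have := hr.missing_eq_one
    have := h₁.missing_eq (by omega)
    omega

theorem Par.bang_inv {n : ℝ≥0∞} {t u : Term} (h : Par (Term.bang n t) u) :
    ∃ t', u = Term.bang n t' ∧ Par t t' := by
  cases h with
  | refl => exact ⟨t, rfl, .refl _⟩
  | bang _ h => exact ⟨_, rfl, h⟩

/-- Orthogonality: reducing the two sides of a redex in parallel does not destroy the redex. -/
theorem Root.stable {t s u t' s' : Term} (h : Root (t ⬝ s) u) (ht : Par t t') (hs : Par s s') :
    ∃ u', Root (t' ⬝ s') u' ∧ Par u u' := by
  cases h with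
  | B x y z =>
    obtain ⟨_, y', rfl, h, hy⟩ := ht.app_inv le_rfl
    obtain ⟨_, x', rfl, h, hx⟩ := h.app_inv (by decide)
    cases h
    exact ⟨_, .B _ _ _, hx.app (hy.app hs)⟩
  | C x y z =>
    obtain ⟨_, y', rfl, h, hy⟩ := ht.app_inv le_rfl
    obtain ⟨_, x', rfl, h, hx⟩ := h.app_inv (by decide)
    cases h
    exact ⟨_, .C _ _ _, (hx.app hs).app hy⟩
  | K x y =>
    obtain ⟨_, x', rfl, h, hx⟩ := ht.app_inv le_rfl
    obtain ⟨y', rfl, hy⟩ := hs.bang_inv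
    cases h
    exact ⟨_, .K _ _, hx⟩
  | D x =>
    obtain ⟨x', rfl, hx⟩ := hs.bang_inv
    cases ht
    exact ⟨_, .D _, hx⟩
  | δ n m x =>
    obtain ⟨x', rfl, hx⟩ := hs.bang_inv
    cases ht
    exact ⟨_, .δ _ _ _, (hx.bang m).bang n⟩
  | F n x y =>
    obtain ⟨_, _, rfl, h, hbang⟩ := ht.app_inv le_rfl
    obtain ⟨x', rfl, hx⟩ := hbang.bang_inv
    obtain ⟨y', rfl, hy⟩ := hs.bang_inv
    cases h
    exact ⟨_, .F _ _ _, (hx.app hy).bang n⟩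
  | W n m x y =>
    obtain ⟨_, x', rfl, h, hx⟩ := ht.app_inv le_rfl
    obtain ⟨y', rfl, hy⟩ := hs.bang_inv
    cases h
    exact ⟨_, .W _ _ _ _, (hx.app (hy.bang n)).app (hy.bang m)⟩

/-- Existence of complete developments.  For an application the witness is obtained by developing
both sides and contracting the result if it is a redex. -/
theorem Par.exists_top (a : Term) : ∃ d, ∀ b, Par a b → Par b d := by
  induction a with
  | bang n t ih =>
    obtain ⟨d, hd⟩ := ih
    refine ⟨Term.bang n d, fun b hb => ?_⟩
    obtain ⟨t', rfl, ht⟩ := hb.bang_inv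
    exact (hd _ ht).bang n
  | app t s iht ihs =>
    obtain ⟨dt, hdt⟩ := iht
    obtain ⟨ds, hds⟩ := ihs
    by_cases hr : ∃ u, Root (dt ⬝ ds) u
    · obtain ⟨u, hu⟩ := hr
      refine ⟨u, fun b hb => ?_⟩
      cases hb with
      | refl => exact .root (hdt _ (.refl _)) (hds _ (.refl _)) hu
      | app h₁ h₂ => exact .root (hdt _ h₁) (hds _ h₂) hu
      | root h₁ h₂ hb =>
        obtain ⟨u', hu', h⟩ := hb.stable (hdt _ h₁) (hds _ h₂)
        rwa [hu.unique hu']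
    · refine ⟨dt ⬝ ds, fun b hb => ?_⟩
      cases hb with
      | refl => exact .app (hdt _ (.refl _)) (hds _ (.refl _))
      | app h₁ h₂ => exact .app (hdt _ h₁) (hds _ h₂)
      | root h₁ h₂ hb =>
        obtain ⟨u', hu', -⟩ := hb.stable (hdt _ h₁) (hds _ h₂)
        exact absurd ⟨u', hu'⟩ hr
  | _ => exact ⟨_, fun b hb => by cases hb; exact .refl _⟩

/-! ### Confluence of the reduction at distance zero -/

/-- Reduction in finitely many steps at distance `0`. -/
abbrev Reds : Term → Term → Prop := ReflTransGen (Step 0)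

theorem gmul_zero (x : ℝ≥0∞) : gmul x 0 = 0 := by simp [gmul]

theorem Root.step {a b : Term} (h : Root a b) (E : Ctx) : Step 0 (E.fill a) (E.fill b) := by
  obtain ⟨l, r, σ, hlr, rfl, rfl⟩ := h.exists_rule
  simpa only [gmul_zero] using Step.ctx E σ hlr

theorem Step.exists_root {ε : ℝ≥0∞} {a b : Term} (h : Step ε a b) :
    ∃ (E : Ctx) (l r : Term), Root l r ∧ E.fill l = a ∧ E.fill r = b := by
  induction h with
  | ctx E σ h => exact ⟨E, _, _, h.root σ, rfl, rfl⟩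
  | weaken _ _ ih => exact ih

theorem Step.zero {ε : ℝ≥0∞} {a b : Term} (h : Step ε a b) : Step 0 a b := by
  obtain ⟨E, l, r, hr, rfl, rfl⟩ := h.exists_root
  exact hr.step E

theorem Root.par {a b : Term} (h : Root a b) : Par a b := by
  cases h <;> exact .root (.refl _) (.refl _) (by constructor)

theorem Par.fill {a b : Term} (h : Par a b) (E : Ctx) : Par (E.fill a) (E.fill b) := by
  induction E with
  | hole => exact h
  | appL E s ih => exact ih.app (.refl s)
  | appR t E ih => exact (Par.refl t).app ih
  | bang n E ih => exact ih.bang n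

theorem Step.par {ε : ℝ≥0∞} {a b : Term} (h : Step ε a b) : Par a b := by
  obtain ⟨E, l, r, hr, rfl, rfl⟩ := h.exists_root
  exact hr.par.fill E

theorem Reds.app {t t' s s' : Term} (ht : Reds t t') (hs : Reds s s') :
    Reds (t ⬝ s) (t' ⬝ s') := by
  refine ReflTransGen.trans (b := t' ⬝ s) (ht.lift (· ⬝ s) fun a b h => ?_)
    (hs.lift (t' ⬝ ·) fun a b h => ?_)
  · obtain ⟨E, l, r, hr, rfl, rfl⟩ := h.exists_root
    exact hr.step (.appL E s)
  · obtain ⟨E, l, r, hr, rfl, rfl⟩ := h.exists_root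
    exact hr.step (.appR t' E)

theorem Reds.bang (n : ℝ≥0∞) {t t' : Term} (ht : Reds t t') :
    Reds (Term.bang n t) (Term.bang n t') := by
  refine ht.lift (Term.bang n) fun a b h => ?_
  obtain ⟨E, l, r, hr, rfl, rfl⟩ := h.exists_root
  exact hr.step (.bang n E)

theorem Par.reds {a b : Term} (h : Par a b) : Reds a b := by
  induction h with
  | refl => exact .refl
  | bang n _ ih => exact Reds.bang n ih
  | app _ _ iht ihs => exact Reds.app iht ihs
  | root _ _ hr iht ihs => exact (Reds.app iht ihs).tail (hr.step .hole)

theorem reflTransGen_par_iff {a b : Term} : ReflTransGen Par a b ↔ Reds a b :=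
  ⟨fun h => reflTransGen_closed (fun _ _ => Par.reds) _ _ h,
    fun h => ReflTransGen.mono (fun _ _ => Step.par) _ _ h⟩

theorem reds_confluent {a b c : Term} (hb : Reds a b) (hc : Reds a c) :
    ∃ d, Reds b d ∧ Reds c d := by
  obtain ⟨d, hbd, hcd⟩ := church_rosser
    (fun a _ _ hb hc =>
      let ⟨d, hd⟩ := Par.exists_top a
      ⟨d, .single (hd _ hb), .single (hd _ hc)⟩)
    (reflTransGen_par_iff.2 hb) (reflTransGen_par_iff.2 hc)
  exact ⟨d, reflTransGen_par_iff.1 hbd, reflTransGen_par_iff.1 hcd⟩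

/-! ### The rewriting distance -/

theorem step_of_systemW_lt_top {a b : Term} (h : systemW a b < ∞) : Step 0 a b := by
  obtain ⟨ε, hε, -⟩ := sInf_lt_iff.1 h
  exact hε.zero

theorem systemW_eq_zero {a b : Term} (h : Step 0 a b) : systemW a b = 0 :=
  nonpos_iff_eq_zero.1 (sInf_le h)

theorem reds_of_iter_lt_top {n : ℕ} {a b : Term} (h : LRel.iter systemW n a b < ∞) :
    Reds a b := by
  induction n generalizing a with
  | zero =>
    obtain ⟨rfl, -⟩ := iInf_lt_iff.1 h
    exact .refl
  | succ n ih =>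
    obtain ⟨c, hc⟩ := iInf_lt_iff.1 h
    obtain ⟨h₁, h₂⟩ := ENNReal.add_lt_top.1 hc
    exact (ih h₂).head (step_of_systemW_lt_top h₁)

theorem reds_of_star_lt_top {a b : Term} (h : LRel.star systemW a b < ∞) : Reds a b :=
  let ⟨_, hn⟩ := iInf_lt_iff.1 h
  reds_of_iter_lt_top hn

theorem star_eq_zero {a b : Term} (h : Reds a b) : LRel.star systemW a b = 0 := by
  suffices ∃ n, LRel.iter systemW n a b = 0 by
    obtain ⟨n, hn⟩ := this
    exact nonpos_iff_eq_zero.1 (iInf_le_of_le n hn.le)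
  induction h using ReflTransGen.head_induction_on with
  | refl => exact ⟨0, by simp [LRel.iter, LRel.diag]⟩
  | @head a c hac _ ih =>
    obtain ⟨n, hn⟩ := ih
    refine ⟨n + 1, nonpos_iff_eq_zero.1 (iInf_le_of_le c ?_)⟩
    rw [systemW_eq_zero hac, hn, add_zero]

end GradedCL

open GradedCL in
theorem mainTheorem3 : LRel.Confluent GradedCL.systemW := by
  intro a b
  -- If the right-hand side is `∞` there is nothing to prove; otherwise the left-hand side is `0`.
  refine le_of_forall_gt fun ε hε => ?_
  obtain ⟨c, hc⟩ := iInf_lt_iff.1 hε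
  obtain ⟨ha, hb⟩ := ENNReal.add_lt_top.1 (hc.trans_le le_top)
  obtain ⟨d, had, hbd⟩ := reds_confluent (reds_of_star_lt_top ha) (reds_of_star_lt_top hb)
  refine iInf_lt_iff.2 ⟨d, ?_⟩
  rw [LRel.dual, star_eq_zero had, star_eq_zero hbd, add_zero]
  exact zero_le.trans_lt hε
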